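/- Let $n\ge 1$ and let $k_1,\dots,k_n\ge 4$ be integers. Let $Q_n$ be the ladder with $n$ squares, i.e. the graph with vertices $t_0,\dots,t_n,b_0,\dots,b_n$ and edges $t_{i-1}t_i$, $b_{i-1}b_i$ ($1\le i\le n$) and $t_ib_i$ ($0\le i\le n$). For a vector $w=(w_2,\dots,w_{n-1})$ of integers with $0\le w_i\le k_i-4$, put $w_1=w_n=0$ and let $P(w)$ be the graph obtained from $Q_n$ by inserting, for every $1\le i\le n$, $w_i$ new vertices into the top edge $t_{i-1}t_i$ and $k_i-4-w_i$ new vertices into the bottom edge $b_{i-1}b_i$. Thus the $i$-th square becomes a polygon of size $k_i$. The graphs $P(w)$ are the polygonal chains with $n$ polygons of sizes $k_1,\dots,k_n$, in this order: the $2$-connected outerplane graphs, all of whose vertices have degree $2$ or $3$, whose interior faces are polygons $H_1,\dots,H_n$ of sizes $k_1,\dots,k_n$, with $H_i$ adjacent to $H_j$ exactly if $|i-j|=1$. For a connected graph $G$ let $r_G(u,v)$ be the effective resistance between the vertices $u$ and $v$ when every edge of $G$ is a unit resistor, and let $K\!f(G)=\sum_{\{u,v\}\subseteq V(G)}r_G(u,v)$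 be the Kirchhoff index of $G$. Theorem. Among all polygonal chains $P(w)$ with $n$ polygons of sizes $k_1,\dots,k_n$, the maximum Kirchhoff index is attained, and it is attained only at linear polygonal chains: if $K\!f(P(w))\ge K\!f(P(w'))$ for all admissible vectors $w'$, then $w_i\in\{\lfloor\frac{k_i-4}{2}\rfloor,\lceil\frac{k_i-4}{2}\rceil\}$ for every $2\le i\le n-1$. -/

import Mathlib

namespace PolygonalChains

section Resistance

open Classical in
/-- Ohm's law and Kirchhoff's current law for the network obtained from `G` by replacing every edge
with a unit resistor: the potential `φ` drives a unit current into the network at `u` and out of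
it at `v`, the net current leaving every other node being zero. -/
def IsUnitCurrentPotential {V : Type*} [Fintype V] (G : SimpleGraph V) (u v : V) (φ : V → ℝ) :
    Prop :=
  ∀ x : V, (∑ y : V, if G.Adj x y then φ x - φ y else 0) =
    (if x = u then 1 else 0) - (if x = v then 1 else 0)

open Classical in
/-- The resistance distance between `u` and `v`: the potential difference between `u` and `v`
under a unit current from `u` to `v`. In a connected graph such potentials exist, and by
`resistance_eq` the potential difference does not depend on the potential. -/
noncomputable def resistance {V : Type*} [Fintype V] (G : SimpleGraph V) (u v : V) : ℝ :=
  if h : ∃ φ : V → ℝ, IsUnitCurrentPotential G u v φ then h.choose u - h.choose v else 0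

/-- The Laplacian form is symmetric. -/
theorem sum_mul_netCurrent_comm {V : Type*} [Fintype V] (G : SimpleGraph V)
    [DecidableRel G.Adj] (φ ψ : V → ℝ) :
    ∑ x : V, ψ x * (∑ y : V, if G.Adj x y then φ x - φ y else 0) =
      ∑ x : V, φ x * (∑ y : V, if G.Adj x y then ψ x - ψ y else 0) := by
  rw [← sub_eq_zero, ← Finset.sum_sub_distrib]
  have h : ∀ x : V, ψ x * (∑ y : V, if G.Adj x y then φ x - φ y else 0) -
      φ x * (∑ y : V, if G.Adj x y then ψ x - ψ y else 0) =
      ∑ y : V, (if G.Adj x y then φ x * ψ y - ψ x * φ y else 0) := by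
    intro x
    rw [Finset.mul_sum, Finset.mul_sum, ← Finset.sum_sub_distrib]
    refine Finset.sum_congr rfl fun y _ => ?_
    split_ifs <;> ring
  rw [Finset.sum_congr rfl fun x _ => h x]
  have hanti : ∑ x : V, ∑ y : V, (if G.Adj x y then φ x * ψ y - ψ x * φ y else 0) =
      -∑ x : V, ∑ y : V, (if G.Adj x y then φ x * ψ y - ψ x * φ y else 0) := by
    conv_lhs => rw [Finset.sum_comm]
    rw [← Finset.sum_neg_distrib]
    refine Finset.sum_congr rfl fun x _ => ?_
    rw [← Finset.sum_neg_distrib]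
    refine Finset.sum_congr rfl fun y _ => ?_
    simp only [G.adj_comm y x]
    split_ifs <;> ring
  linarith

/-- The resistance distance may be computed from any potential of a unit current. -/
theorem resistance_eq {V : Type*} [Fintype V] (G : SimpleGraph V) (u v : V) (φ : V → ℝ)
    (hφ : IsUnitCurrentPotential G u v φ) : resistance G u v = φ u - φ v := by
  classical
  have hex : ∃ ψ : V → ℝ, IsUnitCurrentPotential G u v ψ := ⟨φ, hφ⟩
  rw [resistance, dif_pos hex]
  have hψ := hex.choose_spec
  generalize hex.choose = ψ at hψ
  have key := sum_mul_netCurrent_comm G φ ψ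
  simp only [IsUnitCurrentPotential] at hφ hψ
  have e1 : ∀ x : V, ψ x * (∑ y : V, if G.Adj x y then φ x - φ y else 0) =
      ψ x * ((if x = u then 1 else 0) - (if x = v then 1 else 0)) := by
    intro x; rw [← hφ x]
  have e2 : ∀ x : V, φ x * (∑ y : V, if G.Adj x y then ψ x - ψ y else 0) =
      φ x * ((if x = u then 1 else 0) - (if x = v then 1 else 0)) := by
    intro x; rw [← hψ x]
  rw [Finset.sum_congr rfl fun x _ => e1 x, Finset.sum_congr rfl fun x _ => e2 x] at key
  simpa [mul_sub, Finset.sum_sub_distrib] using key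

/-- The Kirchhoff index: the sum of the resistance distances over all unordered pairs of vertices
(every such pair occurs twice in the double sum, and the diagonal terms vanish). -/
noncomputable def kirchhoffIndex {V : Type*} [Fintype V] (G : SimpleGraph V) : ℝ :=
  (∑ u : V, ∑ v : V, resistance G u v) / 2

end Resistance

section Chains

/-- The vectors encoding the polygonal chains with `n` polygons `H 1, …, H n` of sizes
`k 1, …, k n`: for an inner polygon `H i` (`2 ≤ i ≤ n - 1`), `w i ∈ {0, …, k i - 4}` is the number
of vertices added to the top edge of the `i`-th square of the ladder. On the two end polygons all
new vertices are added to the bottom edge. Indices that carry no entry of the vector are given the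
value `0`. -/
def IsChainVector (n : ℕ) (k w : ℕ → ℕ) : Prop :=
  (∀ i, 2 ≤ i → i < n → w i ≤ k i - 4) ∧ ∀ i, ¬(2 ≤ i ∧ i < n) → w i = 0

/-- The position, on the top path, of the top vertex `t i` of the `i`-th rung of the ladder
(rungs are numbered `0, …, n`, and the `j`-th square lies between the rungs `j - 1` and `j`). -/
def topPos (w : ℕ → ℕ) (i : ℕ) : ℕ := ∑ j ∈ Finset.Icc 1 i, (w j + 1)

/-- The position, on the bottom path, of the bottom vertex `b i` of the `i`-th rung. -/
def botPos (k w : ℕ → ℕ) (i : ℕ) : ℕ := ∑ j ∈ Finset.Icc 1 i, ((k j - 4 - w j) + 1)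

/-- The vertices of the chain: those of the top path, from `t 0` to `t n`, and those of the bottom
path, from `b 0` to `b n`. -/
abbrev ChainVertex (n : ℕ) (k w : ℕ → ℕ) : Type :=
  Fin (topPos w n + 1) ⊕ Fin (botPos k w n + 1)

/-- The edges of the chain, each in one direction: consecutive vertices of the top path,
consecutive vertices of the bottom path, and the rungs `t i, b i` for `0 ≤ i ≤ n`. -/
def chainRel (n : ℕ) (k w : ℕ → ℕ) : ChainVertex n k w → ChainVertex n k w → Prop
  | Sum.inl p, Sum.inl q => (p : ℕ) + 1 = q
  | Sum.inr p, Sum.inr q => (p : ℕ) + 1 = q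
  | Sum.inl p, Sum.inr q => ∃ i ≤ n, (p : ℕ) = topPos w i ∧ (q : ℕ) = botPos k w i
  | Sum.inr _, Sum.inl _ => False

/-- The polygonal chain `P(w)` with `n` polygons of sizes `k 1, …, k n`: the ladder with `n`
squares, with `w i` new vertices on the top edge and `k i - 4 - w i` new vertices on the bottom
edge of the `i`-th square. -/
def polygonalChain (n : ℕ) (k w : ℕ → ℕ) : SimpleGraph (ChainVertex n k w) :=
  SimpleGraph.fromRel (chainRel n k w)

/-- `P(w)` is a linear polygonal chain. -/
def IsLinearChain (n : ℕ) (k w : ℕ → ℕ) : Prop :=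
  ∀ i, 2 ≤ i → i < n →
    (w i : ℤ) = ⌊((k i : ℚ) - 4) / 2⌋ ∨ (w i : ℤ) = ⌈((k i : ℚ) - 4) / 2⌉

end Chains

end PolygonalChains

/-!
A network with two terminals `t` and `b` enters the Kirchhoff index of a larger network, to which it
is attached only at the terminals, through six numbers. With `ρ = r(t, b)`, every vertex `u` has the
potential `ξ u = (r(u, b) - r(u, t)) / 2` (the potential of a unit current from `t` to `b`,
normalised to be odd under exchange of the terminals) and the height
`(r(u, t) + r(u, b) - ρ) / 2`; the six numbers are the number of vertices, `ρ`, `∑ ξ`, `∑ ξ²`, the sum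
of the heights, and the Kirchhoff index. They form a `TwoPole`. Attaching a pendant vertex and adding
an edge between the terminals act on them by explicit rational formulas (`Realizes.pendant`,
`Realizes.addEdge`), and a polygonal chain is built from a single edge by such moves, so its Kirchhoff
index is obtained from the `TwoPole` computed by iterating the formulas
(`kirchhoffIndex_polygonalChain`).

Fix an inner polygon, with `c` and `d` new vertices on its two sides, `c + d` being prescribed. Let
`A` and `B` be the two-poles of the parts of the chain before and after it. Since the moves can be
performed on either side of the junction (`join_sides`, `join_close`), the Kirchhoff index is
`join (sides c d A) B`, and up to a term that depends only on `c + d` and on the data of `A` and `B`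
other than the signs of their biases, it equals a positive multiple of
`(c - d) (x β + y α) - 2 x y - (c - d)² α β / 4`,
where `x`, `y` are the biases `∑ ξ` of `A`, `B`, and `α`, `β` are the numbers of vertices minus one
minus the resistances (`join_sides_sub`). Here `2 |x| < α` and `2 |y| < β`: the contributions of the
two terminals to `x` cancel, the other `|ξ|` are at most `ρ / 2`, and `ρ < 1`. In the formal proof
these bounds come by induction on the number of polygons (`IsBalanced.close_sides`).

If `|c - d| ≥ 2`, the value can be strictly increased. When `c + d` is even, replace `c - d` by `0`
and, if `x y > 0`, also reflect the part after the polygon, which changes the sign of `y` only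
(`chain_flip`, `exists_sign_gain`); with the reflection the gain is a positive multiple of
`((c - d) α / 2 - 2 x) ((c - d) β / 2 - 2 y)`, whose factors have the same sign. When `c + d` is odd,
replace `c - d` by `1` or `-1`, according to the sign of `x β + y α` (`exists_unit_gain`). So a maximal
chain is linear.
-/

namespace PolygonalChains

/-! ### Data of two-terminal networks -/

/-- The data of a network with terminals `t` and `b` that determine how it contributes to the Kirchhoff
index of a network containing it. They are attached to an actual graph by `Realizes`. -/
@[ext]
structure TwoPole where
  /-- The number of vertices. -/
  size : ℝ
  /-- The resistance `ρ` between the terminals. -/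
  res : ℝ
  /-- The sum of the potentials `ξ u = (r(u, b) - r(u, t)) / 2`. It is positive if the vertices lie, on
  average, closer to `t` than to `b`. -/
  bias : ℝ
  /-- The sum of the squares `ξ u ^ 2`. -/
  sq : ℝ
  /-- The sum of the heights `(r(u, t) + r(u, b) - ρ) / 2`, the resistances of the arms at `u` of the
  stars equivalent to the network with respect to `t`, `b`, `u`. -/
  height : ℝ
  /-- The Kirchhoff index. -/
  kf : ℝ

namespace TwoPole

/-- A single edge, whose ends are the terminals. -/
noncomputable def edge : TwoPole := ⟨2, 1, 0, 1 / 2, 0, 1⟩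

/-- Exchange of the two terminals. -/
def flip (D : TwoPole) : TwoPole := { D with bias := -D.bias }

/-- Effect of attaching a pendant vertex to the terminal `t` and making it the new terminal `t`. -/
noncomputable def extTop (D : TwoPole) : TwoPole where
  size := D.size + 1
  res := D.res + 1
  bias := D.bias - D.size / 2 + (D.res + 1) / 2
  sq := D.sq - D.bias + D.size / 4 + (D.res + 1) ^ 2 / 4
  height := D.height
  kf := D.kf + D.height + D.size * (D.res / 2 + 1) - D.bias

/-- Effect of attaching a pendant vertex to the terminal `b` and making it the new terminal `b`. -/
noncomputable def extBot (D : TwoPole) : TwoPole := D.flip.extTop.flip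

/-- Effect of adding an edge between the two terminals. -/
noncomputable def rung (D : TwoPole) : TwoPole where
  size := D.size
  res := D.res / (1 + D.res)
  bias := D.bias / (1 + D.res)
  sq := D.sq / (1 + D.res) ^ 2
  height := D.height + (D.size * D.res ^ 2 / 4 - D.sq) / (1 + D.res)
  kf := D.kf - (D.size * D.sq - D.bias ^ 2) / (1 + D.res)

/-- Effect of prolonging the network by a path of `c` vertices at `t` and a path of `d` vertices
at `b`. -/
noncomputable def sides (c d : ℕ) (D : TwoPole) : TwoPole := extBot^[d] (extTop^[c] D)

/-- Effect of completing a polygon: both terminals are prolonged by one vertex, and the new terminals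
are joined by an edge. -/
noncomputable def close (D : TwoPole) : TwoPole := (extBot (extTop D)).rung

/-- The Kirchhoff index of the network that consists of two networks and two edges, one between their
terminals `t` and one between their terminals `b`. The denominator is the total resistance around the
resulting circuit. -/
noncomputable def join (A B : TwoPole) : ℝ :=
  A.kf + B.kf + B.size * A.height + A.size * B.height
    + A.size * B.size * (A.res + B.res + 2) / 4
    - ((A.size + B.size) * (A.sq + B.sq) - (A.bias - B.bias) ^ 2) / (A.res + B.res + 2)

theorem flip_flip (D : TwoPole) : D.flip.flip = D := by
  simp [flip]

theorem extTop_extBot (D : TwoPole) : extTop (extBot D) = extBot (extTop D) := by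
  ext <;> simp only [extBot, extTop, flip] <;> ring

/-- A vertex on the path between the terminals `t` may be counted with either network. -/
theorem join_extTop {A B : TwoPole} (hA : 0 < A.res) (hB : 0 < B.res) :
    join A.extTop B = join A B.extTop := by
  have h : A.extTop.res + B.res + 2 = A.res + B.extTop.res + 2 := by simp only [extTop]; ring
  have hS : A.res + B.extTop.res + 2 ≠ 0 := by simp only [extTop]; positivity
  simp only [join, h]
  simp only [extTop] at *
  field_simp
  ring

theorem join_flip (A B : TwoPole) : join A.flip B.flip = join A B := by
  simp only [join, flip]; ring

theorem join_extBot {A B : TwoPole} (hA : 0 < A.res) (hB : 0 < B.res) :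
    join A.extBot B = join A B.extBot := by
  have h := join_extTop (A := A.flip) (B := B.flip) hA hB
  rw [extBot, extBot, ← join_flip, flip_flip, h, ← join_flip, flip_flip]

theorem res_extTop_iterate (c : ℕ) (D : TwoPole) : (extTop^[c] D).res = D.res + c := by
  induction c with
  | zero => simp
  | succ c ih =>
    rw [Function.iterate_succ_apply', extTop, ih]
    push_cast; ring

theorem res_extBot_iterate (d : ℕ) (D : TwoPole) : (extBot^[d] D).res = D.res + d := by
  induction d with
  | zero => simp
  | succ d ih =>
    rw [Function.iterate_succ_apply']
    simp only [extBot, extTop, flip, ih]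
    push_cast; ring

theorem extBot_extTop_sides (c d : ℕ) (D : TwoPole) :
    extBot (extTop (sides c d D)) = sides (c + 1) (d + 1) D := by
  have h : Function.Commute extTop extBot := extTop_extBot
  rw [sides, sides, (h.iterate_right d).eq, Function.iterate_succ_apply' extTop,
    Function.iterate_succ_apply' extBot]

theorem join_extTop_iterate (c : ℕ) {A B : TwoPole} (hA : 0 < A.res) (hB : 0 < B.res) :
    join (extTop^[c] A) B = join A (extTop^[c] B) := by
  induction c generalizing A with
  | zero => rfl
  | succ c ih =>
    have hA' : 0 < A.extTop.res := by simp only [extTop]; positivity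
    have hB' : 0 < (extTop^[c] B).res := by rw [res_extTop_iterate]; positivity
    rw [Function.iterate_succ_apply, ih hA', join_extTop hA hB',
      Function.iterate_succ_apply' extTop c B]

theorem join_extBot_iterate (d : ℕ) {A B : TwoPole} (hA : 0 < A.res) (hB : 0 < B.res) :
    join (extBot^[d] A) B = join A (extBot^[d] B) := by
  induction d generalizing A with
  | zero => rfl
  | succ d ih =>
    have hA' : 0 < A.extBot.res := by simp only [extBot, extTop, flip]; positivity
    have hB' : 0 < (extBot^[d] B).res := by rw [res_extBot_iterate]; positivity
    rw [Function.iterate_succ_apply, ih hA', join_extBot hA hB',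
      Function.iterate_succ_apply' extBot d B]

theorem join_sides (c d : ℕ) {A B : TwoPole} (hA : 0 < A.res) (hB : 0 < B.res) :
    join (sides c d A) B = join A (sides c d B) := by
  have h : Function.Commute extTop extBot := extTop_extBot
  have hA' : 0 < (extTop^[c] A).res := by rw [res_extTop_iterate]; positivity
  have hB' : 0 < (extBot^[d] B).res := by rw [res_extBot_iterate]; positivity
  rw [sides, join_extBot_iterate d hA' hB, join_extTop_iterate c hA hB', sides,
    ((h.iterate_left c).iterate_right d).eq]

/-- Completing a polygon amounts to joining the network to a single edge. -/
theorem kf_close {D : TwoPole} (hD : 0 < D.res) : D.close.kf = join D edge := by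
  have h1 : D.res + 3 ≠ 0 := by positivity
  have h4 : 1 + (D.res + 1 + 1) = D.res + 3 := by ring
  have h5 : D.res + 1 + 2 = D.res + 3 := by ring
  simp only [close, rung, extBot, extTop, flip, join, edge, h4, h5]
  obtain ⟨n, a, x, q, u, k⟩ := D
  simp only at *
  field_simp
  ring

/-- A rung between two networks may be counted with either of them. -/
theorem join_close {A B : TwoPole} (hA : 0 < A.res) (hB : 0 < B.res) :
    join A.close B = join A B.close := by
  have h1 : A.res + 3 ≠ 0 := by positivity
  have h2 : B.res + 3 ≠ 0 := by positivity
  have h3 : (A.res + 3) * (B.res + 3) - 1 ≠ 0 := by nlinarith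
  have h4 : 1 + (A.res + 1 + 1) = A.res + 3 := by ring
  have h5 : 1 + (B.res + 1 + 1) = B.res + 3 := by ring
  have h6 : (A.res + 1 + 1) / (A.res + 3) + B.res + 2
      = ((A.res + 3) * (B.res + 3) - 1) / (A.res + 3) := by
    field_simp; ring
  have h7 : A.res + (B.res + 1 + 1) / (B.res + 3) + 2
      = ((A.res + 3) * (B.res + 3) - 1) / (B.res + 3) := by
    field_simp; ring
  simp only [close, rung, extBot, extTop, flip, join, h4, h5, h6, h7]
  obtain ⟨n, a, x, q, u, k⟩ := A
  obtain ⟨n', b, x', q', u', k'⟩ := B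
  simp only at *
  field_simp
  ring

/-! ### Dependence on the two sides of a polygon -/

/-- The number of vertices, minus one, minus the resistance between the terminals. -/
noncomputable def excess (D : TwoPole) : ℝ := D.size - 1 - D.res

/-- Prolonging the terminals one step changes `bias` by the constant `∓ excess / 2`, because `size` and
`res` grow alike. Hence everything depends on `c` and `d` only through `c + d`, except for terms in
`c - d` that are the same for `sq` and for `kf`. -/
theorem sides_eq (c d : ℕ) (D : TwoPole) : sides c d D =
    { size := D.size + (c + d)
      res := D.res + (c + d)
      bias := D.bias - ((c : ℝ) - d) / 2 * D.excess
      sq := D.sq + ∑ s ∈ Finset.range (c + d), ((D.size + s) / 4 + (D.res + s + 1) ^ 2 / 4)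
        - D.excess * (c + d) / 4
        + (((c : ℝ) - d) ^ 2 / 4 * D.excess - ((c : ℝ) - d) * D.bias)
      height := D.height
      kf := D.kf
        + ∑ s ∈ Finset.range (c + d), (D.height + (D.size + s) * ((D.res + s) / 2 + 1))
        - D.excess * (c + d) / 4
        + (((c : ℝ) - d) ^ 2 / 4 * D.excess - ((c : ℝ) - d) * D.bias) } := by
  induction d with
  | zero =>
    induction c with
    | zero => ext <;> simp [sides]
    | succ c ih =>
      have h : sides (c + 1) 0 D = (sides c 0 D).extTop := by
        simp only [sides, Function.iterate_zero, id]
        rw [Function.iterate_succ_apply']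
      rw [h, ih, extTop]
      simp only [Nat.add_zero, Finset.sum_range_succ, excess]
      ext <;> simp only <;> push_cast <;> ring
  | succ d ih =>
    have h : sides c (d + 1) D = (sides c d D).extBot := by
      simp only [sides]
      rw [Function.iterate_succ_apply']
    rw [h, ih]
    simp only [extBot, extTop, flip, ← Nat.add_assoc, Finset.sum_range_succ, excess]
    ext <;> simp only <;> push_cast <;> ring

/-- The dependence of the Kirchhoff index on the distribution of the `c + d` new vertices of a polygon
over its two sides, and on the sign of the bias of the network `B` behind the polygon. -/
theorem join_sides_sub (A B B' : TwoPole) (hA : 0 < A.res) (hB : 0 < B.res)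
    (h1 : B'.size = B.size) (h2 : B'.res = B.res) (h3 : B'.sq = B.sq) (h4 : B'.height = B.height)
    (h5 : B'.kf = B.kf) (h6 : B'.bias ^ 2 = B.bias ^ 2)
    (c d c' d' : ℕ) (h : c' + d' = c + d) :
    (A.res + B.res + (c + d) + 2) * (join (sides c' d' A) B' - join (sides c d A) B) =
      (((c' : ℝ) - d') * (A.bias * B.excess + B'.bias * A.excess) - 2 * (A.bias * B'.bias)
        - ((c' : ℝ) - d') ^ 2 / 4 * (A.excess * B.excess)) -
      (((c : ℝ) - d) * (A.bias * B.excess + B.bias * A.excess) - 2 * (A.bias * B.bias)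
        - ((c : ℝ) - d) ^ 2 / 4 * (A.excess * B.excess)) := by
  have hcast : (c' : ℝ) + d' = c + d := by exact_mod_cast h
  have hS : A.res + (c + d) + B.res + 2 ≠ 0 := by positivity
  rw [sides_eq, sides_eq, h]
  simp only [join, hcast, h1, h2, h3, h4, h5]
  generalize ∑ s ∈ Finset.range (c + d), ((A.size + s) / 4 + (A.res + s + 1) ^ 2 / 4) = e1
  generalize ∑ s ∈ Finset.range (c + d),
    (A.height + (A.size + s) * ((A.res + s) / 2 + 1)) = e2
  simp only [excess]
  field_simp
  linear_combination 16 * (A.res + B.res + (c + d) + 2) * h6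

theorem close_flip (D : TwoPole) : D.flip.close = D.close.flip := by
  have h : extBot (extTop D.flip) = (extBot (extTop D)).flip := by
    rw [← extTop_extBot D]
    simp only [extBot]
  rw [close, close, h]
  simp only [rung, flip]
  ext <;> simp only <;> ring

theorem sides_flip (c d : ℕ) (D : TwoPole) : sides c d D.flip = (sides d c D).flip := by
  rw [sides_eq, sides_eq, Nat.add_comm d c]
  simp only [flip, excess]
  ext <;> simp only <;> ring

/-- For the end polygon of a chain the distribution of the new vertices does not matter, as the bias and
the excess of an edge vanish. -/
theorem sides_edge_eq {c d c' d' : ℕ} (h : c' + d' = c + d) :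
    sides c' d' edge = (sides c d edge).flip := by
  have hcast : (c' : ℝ) + d' = c + d := by exact_mod_cast h
  rw [sides_eq, sides_eq, h]
  simp only [flip, excess, edge, hcast]
  ext <;> simp only <;> ring

/-! ### Data of polygonal chains -/

/-- Bounds that hold for all parts of a polygonal chain that end in a rung. -/
structure IsBalanced (D : TwoPole) : Prop where
  res_pos : 0 < D.res
  res_le_one : D.res ≤ 1
  bias_le : 2 * |D.bias| ≤ D.excess

theorem IsBalanced.edge : IsBalanced edge := by
  constructor <;> norm_num [TwoPole.edge, excess]

/-- The bounds persist under attaching a polygon, and the bound on the bias becomes strict. -/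
theorem IsBalanced.close_sides {D : TwoPole} (hD : D.IsBalanced) (c d : ℕ) :
    (sides c d D).close.IsBalanced ∧
      2 * |(sides c d D).close.bias| < (sides c d D).close.excess := by
  obtain ⟨h0, h1, h2⟩ := hD
  set m : ℝ := (c : ℝ) + d with hm
  have hm0 : 0 ≤ m := by positivity
  have hc : (0 : ℝ) ≤ c := by positivity
  have hd : (0 : ℝ) ≤ d := by positivity
  have hq : 0 ≤ D.excess := le_trans (by positivity) h2
  have hres : (sides c d D).close.res = (D.res + m + 2) / (D.res + m + 3) := by
    rw [sides_eq]
    simp only [close, rung, extBot, extTop, flip, ← hm]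
    congr 1 <;> ring
  have hbias : (sides c d D).close.bias
      = (D.bias - ((c : ℝ) - d) / 2 * D.excess) / (D.res + m + 3) := by
    rw [sides_eq]
    simp only [close, rung, extBot, extTop, flip, ← hm]
    congr 1 <;> ring
  have hsize : (sides c d D).close.size = D.size + m + 2 := by
    rw [sides_eq]
    simp only [close, rung, extBot, extTop, flip, ← hm]
    ring
  have hres1 : (sides c d D).close.res ≤ 1 := by
    rw [hres, div_le_one (by positivity)]; linarith
  have hpos : (0 : ℝ) < D.res + m + 3 := by positivity
  have hnum : 2 * |D.bias - ((c : ℝ) - d) / 2 * D.excess| ≤ (1 + m) * D.excess := by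
    have hb := abs_le.1 (show |D.bias| ≤ D.excess / 2 by linarith)
    have h3 : 0 ≤ c * D.excess := by positivity
    have h4 : 0 ≤ d * D.excess := by positivity
    have h5 : |D.bias - ((c : ℝ) - d) / 2 * D.excess| ≤ (1 + m) * D.excess / 2 := by
      rw [abs_le, hm]
      constructor <;> nlinarith [hb.1, hb.2]
    linarith
  have hlt : 2 * |(sides c d D).close.bias| < (sides c d D).close.excess := by
    have h6 : 2 * |(sides c d D).close.bias| ≤ D.excess := by
      rw [hbias, abs_div, abs_of_pos hpos, ← mul_div_assoc, div_le_iff₀ hpos]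
      nlinarith
    have h7 : D.excess < (sides c d D).close.excess := by
      simp only [excess] at *
      rw [hsize]
      linarith
    linarith
  exact ⟨⟨by rw [hres]; positivity, hres1, hlt.le⟩, hlt⟩

/-- The two-pole of the polygonal chain whose `j`-th polygon has `c j` new vertices on the top side and
`d j` on the bottom side; the terminals are the ends of the last rung. -/
noncomputable def chain (c d : ℕ → ℕ) : ℕ → TwoPole
  | 0 => edge
  | j + 1 => (sides (c (j + 1)) (d (j + 1)) (chain c d j)).close

theorem isBalanced_chain (c d : ℕ → ℕ) (j : ℕ) : (chain c d j).IsBalanced := by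
  induction j with
  | zero => exact IsBalanced.edge
  | succ j ih => exact (ih.close_sides _ _).1

theorem abs_bias_chain_lt (c d : ℕ → ℕ) {j : ℕ} (hj : 1 ≤ j) :
    2 * |(chain c d j).bias| < (chain c d j).excess := by
  obtain ⟨j, rfl⟩ := Nat.exists_eq_add_of_le' hj
  exact ((isBalanced_chain c d j).close_sides _ _).2

theorem chain_congr {c d c' d' : ℕ → ℕ} {l : ℕ} (hc : ∀ j, 1 ≤ j → j ≤ l → c' j = c j)
    (hd : ∀ j, 1 ≤ j → j ≤ l → d' j = d j) : chain c' d' l = chain c d l := by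
  induction l with
  | zero => rfl
  | succ l ih =>
    rw [chain, chain, hc _ (by omega) le_rfl, hd _ (by omega) le_rfl,
      ih (fun j h1 h2 => hc j h1 (by omega)) (fun j h1 h2 => hd j h1 (by omega))]

/-- Exchanging the two sides of all polygons but the first exchanges the terminals. -/
theorem chain_flip {c d c' d' : ℕ → ℕ} {l : ℕ} (h1 : c' 1 + d' 1 = c 1 + d 1)
    (hc : ∀ j, 2 ≤ j → j ≤ l → c' j = d j) (hd : ∀ j, 2 ≤ j → j ≤ l → d' j = c j) :
    chain c' d' l = (chain c d l).flip := by
  induction l with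
  | zero => simp [chain, edge, flip]
  | succ l ih =>
    rw [chain, chain, ← close_flip]
    rcases Nat.eq_zero_or_pos l with rfl | hl
    · rw [chain, chain]
      exact congrArg close (sides_edge_eq h1)
    · rw [hc _ (by omega) le_rfl, hd _ (by omega) le_rfl,
        ih (fun j h1 h2 => hc j h1 (by omega)) (fun j h1 h2 => hd j h1 (by omega)), sides_flip]

/-- The Kirchhoff index of a chain of `n` polygons, computed by cutting it at the polygon with number
`n - l`: the last `l` polygons, in reverse order, form the second network. -/
theorem kf_chain_eq_join (c d : ℕ → ℕ) {n l : ℕ} (hl : l < n) :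
    (chain c d n).kf = join (sides (c (n - l)) (d (n - l)) (chain c d (n - l - 1)))
      (chain (fun j => c (n + 1 - j)) (fun j => d (n + 1 - j)) l) := by
  have hsides : ∀ (a b : ℕ) {D : TwoPole}, 0 < D.res → 0 < (sides a b D).res := by
    intro a b D h
    rw [sides_eq]
    positivity
  induction l with
  | zero =>
    obtain ⟨m, rfl⟩ := Nat.exists_eq_add_of_le' hl
    exact kf_close (hsides _ _ (isBalanced_chain c d m).res_pos)
  | succ l ih =>
    obtain ⟨m, hm⟩ : ∃ m, n - (l + 1) = m + 1 := ⟨n - (l + 1) - 1, by omega⟩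
    have e1 : n - l - 1 = m + 1 := by omega
    have e2 : n + 1 - (l + 1) = n - l := by omega
    have hB := (isBalanced_chain (fun j => c (n + 1 - j)) (fun j => d (n + 1 - j)) l).res_pos
    have hX := hsides (c (m + 1)) (d (m + 1)) (isBalanced_chain c d m).res_pos
    rw [ih (by omega), hm, e1, Nat.add_sub_cancel, join_sides _ _ (isBalanced_chain _ _ _).res_pos hB,
      chain, join_close hX (hsides _ _ hB), chain, e2]

end TwoPole

/-! ### Two real inequalities -/

open TwoPole

/-- The gain from making the two sides of a polygon equally long, possibly with a reflection of the
remaining chain. -/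
theorem exists_sign_gain {a b x y e : ℝ} (hx : 2 * |x| < a) (hy : 2 * |y| < b) (he : 2 ≤ |e|) :
    ∃ s : ℝ, (s = 1 ∨ s = -1) ∧
      e * (x * b + y * a) - 2 * (x * y) - e ^ 2 / 4 * (a * b) < -2 * (x * (s * y)) := by
  have hx1 := abs_lt.1 (show |x| < a / 2 by linarith)
  have hy1 := abs_lt.1 (show |y| < b / 2 by linarith)
  have ha : 0 < a := lt_of_le_of_lt (by positivity) hx
  have hb : 0 < b := lt_of_le_of_lt (by positivity) hy
  have hab : 0 < a * b := mul_pos ha hb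
  rcases le_or_gt (x * y) 0 with hxy | hxy
  · refine ⟨1, Or.inl rfl, ?_⟩
    -- `x * b` and `y * a` have opposite signs and absolute value less than `a * b / 2`
    have hz : |x * b + y * a| < a * b / 2 := by
      rw [abs_lt]
      rcases le_or_gt 0 x with h | h
      · rcases eq_or_lt_of_le h with h | h
        · subst h; constructor <;> nlinarith
        · have : y ≤ 0 := by nlinarith
          constructor <;> nlinarith
      · have : 0 ≤ y := by nlinarith
        constructor <;> nlinarith
    have h1 : e * (x * b + y * a) ≤ |e| * |x * b + y * a| := by
      rw [← abs_mul]; exact le_abs_self _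
    have h2 : |e| * |x * b + y * a| < |e| * (a * b / 2) := by gcongr
    have h3 : |e| * (a * b / 2) ≤ |e| ^ 2 / 4 * (a * b) := by
      nlinarith [mul_nonneg (mul_nonneg (abs_nonneg e) (sub_nonneg.2 he)) hab.le]
    rw [sq_abs] at h3
    linarith
  · refine ⟨-1, Or.inr rfl, ?_⟩
    -- the gain equals this product
    have h : 0 < (e * a / 2 - 2 * x) * (e * b / 2 - 2 * y) := by
      rcases le_abs.1 he with h | h
      · apply mul_pos <;> nlinarith
      · apply mul_pos_of_neg_of_neg <;> nlinarith
    linarith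

/-- The gain from making the lengths of the two sides of a polygon differ by one. -/
theorem exists_unit_gain {a b x y e : ℝ} (hx : 2 * |x| < a) (hy : 2 * |y| < b) (he : 3 ≤ |e|) :
    ∃ s : ℝ, (s = 1 ∨ s = -1) ∧
      e * (x * b + y * a) - e ^ 2 / 4 * (a * b) < s * (x * b + y * a) - s ^ 2 / 4 * (a * b) := by
  have hx1 := abs_lt.1 (show |x| < a / 2 by linarith)
  have hy1 := abs_lt.1 (show |y| < b / 2 by linarith)
  have ha : 0 < a := lt_of_le_of_lt (by positivity) hx
  have hb : 0 < b := lt_of_le_of_lt (by positivity) hy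
  have hab : 0 < a * b := mul_pos ha hb
  have hz1 : x * b + y * a < a * b := by nlinarith
  have hz2 : -(a * b) < x * b + y * a := by nlinarith
  generalize x * b + y * a = z at *
  generalize a * b = p at *
  rcases le_or_gt 0 z with h | h
  · refine ⟨1, Or.inl rfl, ?_⟩
    rcases le_abs.1 he with h' | h'
    · have h1 : 0 < (e - 1) * (p - z) := mul_pos (by linarith) (by linarith)
      have h2 : 0 ≤ (e - 1) * (e - 3) * p := mul_nonneg (mul_nonneg (by linarith) (by linarith)) hab.le
      nlinarith
    · have h1 : 0 ≤ z * (1 - e) := mul_nonneg h (by linarith)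
      have h2 : 0 < (1 - e) * (-e - 1) * p := mul_pos (mul_pos (by linarith) (by linarith)) hab
      nlinarith
  · refine ⟨-1, Or.inr rfl, ?_⟩
    rcases le_abs.1 he with h' | h'
    · have h1 : 0 < -z * (1 + e) := mul_pos (neg_pos.2 h) (by linarith)
      have h2 : 0 < (1 + e) * (e - 1) * p := mul_pos (mul_pos (by linarith) (by linarith)) hab
      nlinarith
    · have h1 : 0 < (-e - 1) * (p + z) := mul_pos (by linarith) (by linarith)
      have h2 : 0 ≤ (-e - 1) * (-e - 3) * p :=
        mul_nonneg (mul_nonneg (by linarith) (by linarith)) hab.le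
      nlinarith

/-! ### Resistances in two-terminal networks -/

section Network
variable {V W : Type*} [Fintype V] [Fintype W]

open Classical in
/-- The net current that leaves the node `x` under the potential `φ`, every edge being a unit resistor. -/
noncomputable def netCurrent (G : SimpleGraph V) (φ : V → ℝ) (x : V) : ℝ :=
  ∑ y : V, if G.Adj x y then φ x - φ y else 0

open Classical in
/-- `R` has the properties that characterise the matrix of resistance distances: it is symmetric with
zero diagonal, and the currents of the potentials `R · v / 2` and of `R · u / 2` differ by a unit
current from `u` to `v`. The latter is expressed by a function `c` that does not depend on `v`. -/
structure IsResistanceMatrix (G : SimpleGraph V) (R : V → V → ℝ) : Prop where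
  symm : ∀ u v, R u v = R v u
  diag : ∀ u, R u u = 0
  law : ∃ c : V → ℝ, ∀ v x, netCurrent G (fun y => R y v) x = 2 * (c x - if x = v then 1 else 0)

theorem IsResistanceMatrix.resistance_eq {G : SimpleGraph V} {R : V → V → ℝ}
    (h : IsResistanceMatrix G R) (u v : V) : resistance G u v = R u v := by
  classical
  obtain ⟨c, hc⟩ := h.law
  have hp : IsUnitCurrentPotential G u v (fun x => (R x v - R x u) / 2) := by
    intro x
    have h1 := hc u x
    have h2 := hc v x
    simp only [netCurrent] at h1 h2
    have h3 : ∀ y, (if G.Adj x y then (R x v - R x u) / 2 - (R y v - R y u) / 2 else 0) =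
        ((if G.Adj x y then R x v - R y v else 0) - if G.Adj x y then R x u - R y u else 0) / 2 := by
      intro y; split_ifs <;> ring
    rw [Finset.sum_congr rfl fun y _ => h3 y, ← Finset.sum_div, Finset.sum_sub_distrib, h1, h2]
    ring
  rw [PolygonalChains.resistance_eq G u v _ hp, h.diag, h.diag, h.symm v u]
  ring

/-- The potential of a unit current from `t` to `b`, expressed by resistances and normalised so that
it takes opposite values at `t` and `b`. -/
noncomputable def potential (R : V → V → ℝ) (t b u : V) : ℝ := (R u b - R u t) / 2

/-- The data of the network with resistance matrix `R` and terminals `t`, `b`. -/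
noncomputable def twoPole (R : V → V → ℝ) (t b : V) : TwoPole where
  size := Fintype.card V
  res := R t b
  bias := ∑ u, potential R t b u
  sq := ∑ u, potential R t b u ^ 2
  height := ∑ u, (R u t + R u b - R t b) / 2
  kf := (∑ u, ∑ v, R u v) / 2

/-- The network `G` with terminals `t`, `b` has a resistance matrix, and its data are `D`. -/
def Realizes (G : SimpleGraph V) (t b : V) (D : TwoPole) : Prop :=
  ∃ R, IsResistanceMatrix G R ∧ twoPole R t b = D

theorem Realizes.kirchhoffIndex_eq {G : SimpleGraph V} {t b : V} {D : TwoPole}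
    (h : Realizes G t b D) : kirchhoffIndex G = D.kf := by
  obtain ⟨R, hR, rfl⟩ := h
  simp only [kirchhoffIndex, twoPole, hR.resistance_eq]

theorem Realizes.flip {G : SimpleGraph V} {t b : V} {D : TwoPole}
    (h : Realizes G t b D) : Realizes G b t D.flip := by
  obtain ⟨R, hR, rfl⟩ := h
  refine ⟨R, hR, ?_⟩
  have h1 : ∀ u, potential R b t u = -potential R t b u := fun u => by
    simp only [potential]; ring
  ext
  · rfl
  · exact hR.symm b t
  · simp [twoPole, TwoPole.flip, h1]
  · simp [twoPole, TwoPole.flip, h1]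
  · simp only [twoPole, TwoPole.flip, hR.symm b t]
    exact Finset.sum_congr rfl fun u _ => by ring
  · rfl

theorem Realizes.iso {G : SimpleGraph V} {t b : V} {D : TwoPole} (h : Realizes G t b D)
    {H : SimpleGraph W} (e : G ≃g H) : Realizes H (e t) (e b) D := by
  classical
  obtain ⟨R, hR, rfl⟩ := h
  have hsum : ∀ f : W → ℝ, ∑ u, f u = ∑ u, f (e u) := fun f => (e.toEquiv.sum_comp f).symm
  refine ⟨fun u v => R (e.symm u) (e.symm v), ⟨fun u v => hR.symm _ _, fun u => hR.diag _, ?_⟩, ?_⟩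
  · obtain ⟨c, hc⟩ := hR.law
    refine ⟨fun x => c (e.symm x), fun v x => ?_⟩
    obtain ⟨x, rfl⟩ := e.surjective x
    obtain ⟨v, rfl⟩ := e.surjective v
    have := hc v x
    simp only [netCurrent, hsum] at this ⊢
    simpa [e.map_adj_iff] using this
  · ext <;> simp [twoPole, potential, hsum, Fintype.card_congr e.toEquiv]

/-- The graph `G` with a new vertex `none` attached to `t`. -/
def pendant (G : SimpleGraph V) (t : V) : SimpleGraph (Option V) where
  Adj
    | some x, some y => G.Adj x y
    | some x, none => x = t
    | none, some y => y = t
    | none, none => False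
  symm := ⟨by
    rintro (_ | x) (_ | y) h
    · exact h
    · exact h
    · exact h
    · exact SimpleGraph.Adj.symm (G := G) h⟩
  loopless := ⟨by
    rintro (_ | x) h
    · exact h
    · exact G.loopless.irrefl x h⟩

theorem Realizes.pendant {G : SimpleGraph V} {t b : V} {D : TwoPole} (h : Realizes G t b D) :
    Realizes (pendant G t) none (some b) D.extTop := by
  classical
  obtain ⟨R, hR, rfl⟩ := h
  let R' : Option V → Option V → ℝ
    | some x, some y => R x y
    | some x, none => R x t + 1
    | none, some y => R y t + 1
    | none, none => 0
  have e1 : ∀ x y, R' (some x) (some y) = R x y := fun _ _ => rfl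
  have e2 : ∀ x, R' (some x) none = R x t + 1 := fun _ => rfl
  have e3 : ∀ x, R' none (some x) = R x t + 1 := fun _ => rfl
  have e4 : R' none none = 0 := rfl
  have a1 : ∀ x y, (PolygonalChains.pendant G t).Adj (some x) (some y) ↔ G.Adj x y :=
    fun _ _ => Iff.rfl
  have a2 : ∀ x, (PolygonalChains.pendant G t).Adj (some x) none ↔ x = t := fun _ => Iff.rfl
  have a3 : ∀ x, (PolygonalChains.pendant G t).Adj none (some x) ↔ x = t := fun _ => Iff.rfl
  refine ⟨R', ⟨?_, ?_, ?_⟩, ?_⟩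
  · rintro (_ | x) (_ | y)
    · rfl
    · rfl
    · rfl
    · exact hR.symm x y
  · rintro (_ | x)
    · rfl
    · exact hR.diag x
  · obtain ⟨c, hc⟩ := hR.law
    refine ⟨fun x => x.elim (1 / 2) fun x => c x - if x = t then 1 / 2 else 0, ?_⟩
    rintro (_ | v) (_ | x)
    · simp [netCurrent, Fintype.sum_option, a3, e2, e4, hR.diag]
      norm_num
    · have := hc t x
      simp only [netCurrent] at this
      simp only [netCurrent, Fintype.sum_option, a1, a2, e2, e4, add_sub_add_right_eq_sub, this]
      by_cases hx : x = t
      · subst hx; simp [hR.diag]; ring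
      · simp [hx]
    · simp [netCurrent, Fintype.sum_option, a3, e1, e3, hR.symm v t]
    · have := hc v x
      simp only [netCurrent] at this
      simp only [netCurrent, Fintype.sum_option, a1, a2, e1, e3, this]
      by_cases hx : x = t
      · subst hx; simp [hR.symm v x]; ring
      · simp [hx]
  · have hR1 : ∀ u, R u t = (R u t + R u b - R t b) / 2 + R t b / 2 - potential R t b u := by
      intro u; simp only [potential]; ring
    have hsum : ∑ u, R u t = ∑ u, (R u t + R u b - R t b) / 2
        + Fintype.card V * (R t b / 2) - ∑ u, potential R t b u := by
      rw [Finset.sum_congr rfl fun u _ => hR1 u, Finset.sum_sub_distrib, Finset.sum_add_distrib]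
      simp
    have hp : ∀ u, potential R' none (some b) (some u) = potential R t b u - 1 / 2 := by
      intro u; simp only [potential, e1, e2]; ring
    have hp' : potential R' none (some b) none = (R t b + 1) / 2 := by
      simp only [potential, e3, e4, hR.symm b t]; ring
    ext
    · simp [twoPole, extTop]
    · simp [twoPole, extTop, e3, hR.symm b t]
    · simp only [twoPole, extTop, Fintype.sum_option, hp, hp', Finset.sum_sub_distrib]
      simp; ring
    · simp only [twoPole, extTop, Fintype.sum_option, hp, hp', sub_sq, Finset.sum_sub_distrib,
        Finset.sum_add_distrib]
      simp [← Finset.sum_mul, ← Finset.mul_sum]; ring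
    · simp only [twoPole, extTop, Fintype.sum_option, e1, e2, e3, e4, hR.symm b t]
      simp only [zero_add, sub_self, zero_div]
      exact Finset.sum_congr rfl fun u _ => by ring
    · simp only [twoPole, extTop, Fintype.sum_option, e1, e2, e3, e4, Finset.sum_add_distrib, hsum]
      simp; ring

/-- An added edge between the terminals lowers the resistance of `u` and `v` by
`(ξ u - ξ v) ^ 2 / (1 + ρ)`. -/
theorem Realizes.addEdge {G H : SimpleGraph V} {t b : V} {D : TwoPole} (h : Realizes G t b D)
    (hD : 0 < D.res) (hne : t ≠ b) (hG : ¬G.Adj t b)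
    (hH : ∀ x y, H.Adj x y ↔ G.Adj x y ∨ (x = t ∧ y = b) ∨ (x = b ∧ y = t)) :
    Realizes H t b D.rung := by
  classical
  obtain ⟨R, hR, rfl⟩ := h
  simp only [twoPole] at hD
  set ξ := potential R t b with hξ
  set ρ := R t b with hρ
  have hρ1 : 1 + ρ ≠ 0 := by positivity
  have ht : ξ t = ρ / 2 := by simp [hξ, potential, hR.diag, hρ]
  have hb : ξ b = -ρ / 2 := by simp [hξ, potential, hR.diag, hρ, hR.symm b t]
  have hG' : ¬G.Adj b t := fun h => hG h.symm
  -- the added edge contributes currents at its two ends only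
  have hcur : ∀ φ x, netCurrent H φ x = netCurrent G φ x +
      ((if x = t then φ t - φ b else 0) + if x = b then φ b - φ t else 0) := by
    intro φ x
    have h1 : ∀ y, (if H.Adj x y then φ x - φ y else 0) = (if G.Adj x y then φ x - φ y else 0) +
        ((if y = b then (if x = t then φ t - φ b else 0) else 0) +
          if y = t then (if x = b then φ b - φ t else 0) else 0) := by
      intro y
      rw [if_congr (hH x y) rfl rfl]
      by_cases hxt : x = t <;> by_cases hyb : y = b <;> by_cases hxb : x = b <;>
        by_cases hyt : y = t <;> simp_all
    simp only [netCurrent]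
    rw [Finset.sum_congr rfl fun y _ => h1 y, Finset.sum_add_distrib, Finset.sum_add_distrib]
    simp
  obtain ⟨c, hc⟩ := hR.law
  refine ⟨fun x v => R x v - (ξ x - ξ v) ^ 2 / (1 + ρ), ⟨fun u v => ?_, fun u => ?_, ?_⟩, ?_⟩
  · rw [hR.symm u v]; ring
  · simp [hR.diag]
  · have hcξ : ∀ x, netCurrent G ξ x = (if x = t then 1 else 0) - if x = b then 1 else 0 := by
      intro x
      have h1 := hc t x
      have h2 := hc b x
      simp only [netCurrent] at h1 h2 ⊢
      have h3 : ∀ y, (if G.Adj x y then ξ x - ξ y else 0) =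
          ((if G.Adj x y then R x b - R y b else 0) -
            if G.Adj x y then R x t - R y t else 0) / 2 := by
        intro y; simp only [hξ, potential]; split_ifs <;> ring
      rw [Finset.sum_congr rfl fun y _ => h3 y, ← Finset.sum_div, Finset.sum_sub_distrib, h1, h2]
      ring
    refine ⟨fun x => c x - netCurrent G (fun y => ξ y ^ 2) x / (2 * (1 + ρ)), fun v x => ?_⟩
    have h4 : netCurrent G (fun y => R y v - (ξ y - ξ v) ^ 2 / (1 + ρ)) x =
        netCurrent G (fun y => R y v) x - (netCurrent G (fun y => ξ y ^ 2) x
          - 2 * ξ v * netCurrent G ξ x) / (1 + ρ) := by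
      simp only [netCurrent]
      rw [Finset.mul_sum, ← Finset.sum_sub_distrib, Finset.sum_div, ← Finset.sum_sub_distrib]
      refine Finset.sum_congr rfl fun y _ => ?_
      split_ifs
      · ring
      · ring
    have h5 : R t v - R b v = -2 * ξ v := by
      simp only [hξ, potential, hR.symm v]; ring
    rw [hcur, h4, hc, hcξ, ht, hb]
    have h6 : R t v - (ρ / 2 - ξ v) ^ 2 / (1 + ρ) - (R b v - (-ρ / 2 - ξ v) ^ 2 / (1 + ρ))
        = - 2 * ξ v / (1 + ρ) := by
      rw [show R t v = R b v + -2 * ξ v by linarith]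
      field_simp; ring
    have h7 : R b v - (-ρ / 2 - ξ v) ^ 2 / (1 + ρ) - (R t v - (ρ / 2 - ξ v) ^ 2 / (1 + ρ))
        = 2 * ξ v / (1 + ρ) := by
      rw [← neg_sub, h6]; ring
    rw [h6, h7]
    by_cases hxt : x = t
    · simp only [hxt, hne, if_true, if_false]
      field_simp; ring
    · by_cases hxb : x = b
      · simp only [hxb, hne.symm, if_true, if_false]
        field_simp; ring
      · simp only [hxt, hxb, if_false]
        field_simp; ring
  · have hres : R t b - (ξ t - ξ b) ^ 2 / (1 + ρ) = ρ / (1 + ρ) := by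
      rw [ht, hb, ← hρ]; field_simp; ring
    have hξu : ∀ u, R u b = R u t + 2 * ξ u := fun u => by simp only [hξ, potential]; ring
    have hp : ∀ u, potential (fun x v => R x v - (ξ x - ξ v) ^ 2 / (1 + ρ)) t b u
        = ξ u / (1 + ρ) := by
      intro u
      simp only [potential, ht, hb, hξu]; field_simp; ring
    ext
    · rfl
    · exact hres
    · simp only [twoPole, rung, hp, Finset.sum_div]
      rfl
    · simp only [twoPole, rung, hp, Finset.sum_div, div_pow]
      rfl
    · simp only [twoPole, rung, hres]
      have : ∀ u, (R u t - (ξ u - ξ t) ^ 2 / (1 + ρ) + (R u b - (ξ u - ξ b) ^ 2 / (1 + ρ)) -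
          ρ / (1 + ρ)) / 2 = (R u t + R u b - ρ) / 2 + (ρ ^ 2 / 4 - ξ u ^ 2) / (1 + ρ) := by
        intro u
        rw [ht, hb]; field_simp; ring
      rw [Finset.sum_congr rfl fun u _ => this u, Finset.sum_add_distrib, ← Finset.sum_div,
        Finset.sum_sub_distrib]
      simp only [Finset.sum_sub_distrib, ← Finset.sum_div, Finset.sum_const, Finset.card_univ,
        nsmul_eq_mul, mul_div_assoc]
      rfl
    · simp only [twoPole, rung, Finset.sum_sub_distrib, ← Finset.sum_div]
      have : ∑ u, ∑ v, (ξ u - ξ v) ^ 2 =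
          2 * (Fintype.card V * ∑ u, ξ u ^ 2 - (∑ u, ξ u) ^ 2) := by
        simp only [sub_sq, Finset.sum_add_distrib, Finset.sum_sub_distrib, ← Finset.mul_sum,
          ← Finset.sum_mul, Finset.sum_const, Finset.card_univ, nsmul_eq_mul]
        ring
      rw [this]
      ring

end Network

/-! ### Ladders -/

section Ladder

/-- The edges of a ladder, each in one direction: those of the top path, those of the bottom path, and
the rungs. -/
def ladderRel (p q : ℕ) (E : ℕ → ℕ → Prop) :
    Fin (p + 1) ⊕ Fin (q + 1) → Fin (p + 1) ⊕ Fin (q + 1) → Prop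
  | Sum.inl x, Sum.inl y => (x : ℕ) + 1 = y
  | Sum.inr x, Sum.inr y => (x : ℕ) + 1 = y
  | Sum.inl x, Sum.inr y => E x y
  | Sum.inr _, Sum.inl _ => False

/-- The graph consisting of a top path with positions `0, …, p`, a bottom path with positions `0, …, q`,
and a rung from `x` to `y` whenever `E x y`. -/
def ladder (p q : ℕ) (E : ℕ → ℕ → Prop) : SimpleGraph (Fin (p + 1) ⊕ Fin (q + 1)) :=
  SimpleGraph.fromRel (ladderRel p q E)

/-- The data of a ladder whose terminals are the last vertices of the two paths. -/
abbrev LadderRealizes (p q : ℕ) (E : ℕ → ℕ → Prop) (D : TwoPole) : Prop :=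
  Realizes (ladder p q E) (Sum.inl (Fin.last p)) (Sum.inr (Fin.last q)) D

variable {p q : ℕ} {E : ℕ → ℕ → Prop} {D : TwoPole}

@[simp] theorem ladder_adj_inl_inl (x y : Fin (p + 1)) :
    (ladder p q E).Adj (Sum.inl x) (Sum.inl y) ↔ (x : ℕ) + 1 = y ∨ (y : ℕ) + 1 = x := by
  simp only [ladder, SimpleGraph.fromRel_adj, ladderRel, ne_eq, Sum.inl.injEq, Fin.ext_iff]
  omega

@[simp] theorem ladder_adj_inr_inr (x y : Fin (q + 1)) :
    (ladder p q E).Adj (Sum.inr x) (Sum.inr y) ↔ (x : ℕ) + 1 = y ∨ (y : ℕ) + 1 = x := by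
  simp only [ladder, SimpleGraph.fromRel_adj, ladderRel, ne_eq, Sum.inr.injEq, Fin.ext_iff]
  omega

@[simp] theorem ladder_adj_inl_inr (x : Fin (p + 1)) (y : Fin (q + 1)) :
    (ladder p q E).Adj (Sum.inl x) (Sum.inr y) ↔ E x y := by
  simp [ladder, SimpleGraph.fromRel_adj, ladderRel]

@[simp] theorem ladder_adj_inr_inl (x : Fin (p + 1)) (y : Fin (q + 1)) :
    (ladder p q E).Adj (Sum.inr y) (Sum.inl x) ↔ E x y := by
  simp [ladder, SimpleGraph.fromRel_adj, ladderRel]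

theorem LadderRealizes.extTop (h : LadderRealizes p q E D) (hE : ∀ y ≤ q, ¬E (p + 1) y) :
    LadderRealizes (p + 1) q E D.extTop := by
  let f : Option (Fin (p + 1) ⊕ Fin (q + 1)) → Fin (p + 1 + 1) ⊕ Fin (q + 1)
    | none => Sum.inl (Fin.last (p + 1))
    | some (Sum.inl x) => Sum.inl x.castSucc
    | some (Sum.inr y) => Sum.inr y
  have hf : Function.Bijective f := by
    rw [Fintype.bijective_iff_injective_and_card]
    constructor
    · rintro (_ | x | x) (_ | y | y) h <;> simp [f, Fin.ext_iff] at h ⊢ <;> omega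
    · simp; omega
  let e : pendant (ladder p q E) (Sum.inl (Fin.last p)) ≃g ladder (p + 1) q E :=
    { Equiv.ofBijective f hf with
      map_rel_iff' := by
        rintro (_ | x | x) (_ | y | y) <;> 
          simp [f, pendant, Fin.ext_iff] <;> first | omega | skip
        · exact hE y (by omega)
        · exact hE x (by omega) }
  exact h.pendant.iso e

theorem LadderRealizes.extBot (h : LadderRealizes p q E D) (hE : ∀ x ≤ p, ¬E x (q + 1)) :
    LadderRealizes p (q + 1) E D.extBot := by
  let f : Option (Fin (p + 1) ⊕ Fin (q + 1)) → Fin (p + 1) ⊕ Fin (q + 1 + 1)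
    | none => Sum.inr (Fin.last (q + 1))
    | some (Sum.inl x) => Sum.inl x
    | some (Sum.inr y) => Sum.inr y.castSucc
  have hf : Function.Bijective f := by
    rw [Fintype.bijective_iff_injective_and_card]
    constructor
    · rintro (_ | x | x) (_ | y | y) h <;> simp [f, Fin.ext_iff] at h ⊢ <;> omega
    · simp; omega
  let e : pendant (ladder p q E) (Sum.inr (Fin.last q)) ≃g ladder p (q + 1) E :=
    { Equiv.ofBijective f hf with
      map_rel_iff' := by
        rintro (_ | x | x) (_ | y | y) <;>
          simp [f, pendant, Fin.ext_iff] <;> first | omega | skip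
        · exact hE y (by omega)
        · exact hE x (by omega) }
  exact (h.flip.pendant.iso e).flip

theorem LadderRealizes.extTop_iterate (h : LadderRealizes p q E D) (c : ℕ)
    (hE : ∀ x y, E x y → x ≤ p) : LadderRealizes (p + c) q E (TwoPole.extTop^[c] D) := by
  induction c with
  | zero => exact h
  | succ c ih =>
    rw [Function.iterate_succ_apply']
    exact ih.extTop fun y _ hy => by have := hE _ _ hy; omega

theorem LadderRealizes.extBot_iterate (h : LadderRealizes p q E D) (d : ℕ)
    (hE : ∀ x y, E x y → y ≤ q) : LadderRealizes p (q + d) E (TwoPole.extBot^[d] D) := by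
  induction d with
  | zero => exact h
  | succ d ih =>
    rw [Function.iterate_succ_apply']
    exact ih.extBot fun y _ hy => by have := hE _ _ hy; omega

theorem LadderRealizes.rung (h : LadderRealizes p q E D) (hD : 0 < D.res) (hE : ¬E p q) :
    LadderRealizes p q (fun x y => E x y ∨ x = p ∧ y = q) D.rung := by
  refine h.addEdge hD (by simp) (by simpa using hE) ?_
  rintro (x | x) (y | y) <;> simp [Fin.ext_iff, and_comm]

theorem ladderRealizes_edge : LadderRealizes 0 0 (fun x y => x = 0 ∧ y = 0) edge := by
  classical
  refine ⟨fun x y => if x = y then 0 else 1, ⟨fun u v => by simp only [eq_comm], by simp, ?_⟩, ?_⟩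
  · refine ⟨fun _ => 1 / 2, ?_⟩
    rintro (v | v) (x | x) <;> obtain rfl : v = 0 := Fin.ext (by omega) <;>
      obtain rfl : x = 0 := Fin.ext (by omega) <;> simp [netCurrent] <;> norm_num
  · ext <;> simp [twoPole, potential, edge] <;> norm_num

end Ladder

/-! ### Kirchhoff index of polygonal chains -/

section Chain
variable (n : ℕ) (k w : ℕ → ℕ)

theorem polygonalChain_eq_ladder : polygonalChain n k w = ladder (topPos w n) (botPos k w n)
    (fun x y => ∃ i ≤ n, x = topPos w i ∧ y = botPos k w i) := by
  rw [polygonalChain, ladder]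
  congr 1
  funext u v
  rcases u with u | u <;> rcases v with v | v <;> rfl

theorem topPos_succ : topPos w (n + 1) = topPos w n + (w (n + 1) + 1) := by
  rw [topPos, Finset.sum_Icc_succ_top (by omega), ← topPos]

theorem botPos_succ : botPos k w (n + 1) = botPos k w n + (k (n + 1) - 4 - w (n + 1) + 1) := by
  rw [botPos, Finset.sum_Icc_succ_top (by omega), ← botPos]

theorem topPos_mono : Monotone (topPos w) :=
  monotone_nat_of_le_succ fun n => by rw [topPos_succ]; omega

theorem botPos_mono : Monotone (botPos k w) :=
  monotone_nat_of_le_succ fun n => by rw [botPos_succ]; omega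

/-- The two-pole of the polygonal chain `P(w)`. -/
noncomputable def chainPole : TwoPole := chain w (fun j => k j - 4 - w j) n

theorem ladderRealizes_chainPole : LadderRealizes (topPos w n) (botPos k w n)
    (fun x y => ∃ i ≤ n, x = topPos w i ∧ y = botPos k w i) (chainPole n k w) := by
  induction n with
  | zero =>
    convert ladderRealizes_edge using 3
    · simp [topPos]
    · simp [botPos]
    · simp [topPos, botPos]
    · rfl
  | succ n ih =>
    have hX := ((ih.extTop_iterate (w (n + 1) + 1) ?_).extBot_iterate
      (k (n + 1) - 4 - w (n + 1) + 1) ?_)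
    · rw [← topPos_succ, ← botPos_succ] at hX
      have hres : 0 < (TwoPole.extBot^[k (n + 1) - 4 - w (n + 1) + 1]
          (TwoPole.extTop^[w (n + 1) + 1] (chainPole n k w))).res := by
        rw [res_extBot_iterate, res_extTop_iterate]
        have := (isBalanced_chain w (fun j => k j - 4 - w j) n).res_pos
        rw [chainPole]
        positivity
      have h := hX.rung hres ?_
      · rw [chainPole, chain, close, extBot_extTop_sides]
        convert h using 3 with x y
        · constructor
          · rintro ⟨i, hi, h1, h2⟩
            rcases Nat.lt_or_ge n i with h | h
            · obtain rfl : i = n + 1 := by omega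
              exact Or.inr ⟨h1, h2⟩
            · exact Or.inl ⟨i, h, h1, h2⟩
          · rintro (⟨i, hi, h1, h2⟩ | ⟨h1, h2⟩)
            · exact ⟨i, by omega, h1, h2⟩
            · exact ⟨n + 1, le_rfl, h1, h2⟩
        · rfl
      · rintro ⟨i, hi, h1, -⟩
        have := topPos_mono w hi
        rw [topPos_succ] at h1
        omega
    · rintro x y ⟨i, hi, rfl, -⟩
      exact topPos_mono w hi
    · rintro x y ⟨i, hi, -, rfl⟩
      exact botPos_mono k w hi

theorem kirchhoffIndex_polygonalChain :
    kirchhoffIndex (polygonalChain n k w) = (chainPole n k w).kf := by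
  rw [polygonalChain_eq_ladder]
  exact (ladderRealizes_chainPole n k w).kirchhoffIndex_eq

theorem finite_isChainVector : {w | IsChainVector n k w}.Finite := by
  refine (Set.finite_range fun (f : ∀ i : Fin n, Fin (k i - 4 + 1)) (i : ℕ) =>
    if h : i < n then (f ⟨i, h⟩ : ℕ) else 0).subset ?_
  rintro w ⟨h1, h2⟩
  refine ⟨fun i => ⟨w i, ?_⟩, ?_⟩
  · by_cases h : 2 ≤ (i : ℕ) ∧ (i : ℕ) < n
    · have := h1 i h.1 h.2; omega
    · rw [h2 i h]; omega
  · funext i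
    by_cases h : i < n
    · simp [h]
    · simp [h, h2 i (by omega)]

variable {n k w}

/-- A chain in which the two sides of some inner polygon differ by at least two new vertices does not
have the maximum Kirchhoff index. -/
theorem exists_kf_lt (hw : IsChainVector n k w) {i : ℕ} (hi : 2 ≤ i) (hin : i < n)
    (hbad : 2 * w i + 2 ≤ k i - 4 ∨ k i - 4 + 2 ≤ 2 * w i) :
    ∃ w', IsChainVector n k w' ∧ (chainPole n k w).kf < (chainPole n k w').kf := by
  obtain ⟨hw1, hw2⟩ := hw
  have hwi := hw1 i hi hin
  have hni : n - (n - i) = i := by omega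
  set A := chainPole (i - 1) k w with hA
  have hrev : ∀ v : ℕ → ℕ, (∀ j, j < i → v j = w j) → (chainPole n k v).kf =
      join (sides (v i) (k i - 4 - v i) A)
        (chain (fun j => v (n + 1 - j)) (fun j => k (n + 1 - j) - 4 - v (n + 1 - j)) (n - i)) := by
    intro v hv
    rw [chainPole, kf_chain_eq_join _ _ (show n - i < n by omega), hni]
    congr 2
    exact chain_congr (fun j _ _ => hv j (by omega)) fun j _ _ => by rw [hv j (by omega)]
  set B := chain (fun j => w (n + 1 - j)) (fun j => k (n + 1 - j) - 4 - w (n + 1 - j)) (n - i)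
    with hB
  have hA0 : 0 < A.res := (isBalanced_chain _ _ _).res_pos
  have hB0 : 0 < B.res := (isBalanced_chain _ _ _).res_pos
  have hA1 : 2 * |A.bias| < A.excess := abs_bias_chain_lt _ _ (by omega)
  have hB1 : 2 * |B.bias| < B.excess := abs_bias_chain_lt _ _ (by omega)
  -- changing the `i`-th polygon alone
  have hupd : ∀ c ≤ k i - 4, IsChainVector n k (Function.update w i c) ∧
      (chainPole n k (Function.update w i c)).kf = join (sides c (k i - 4 - c) A) B := by
    intro c hc
    refine ⟨⟨fun j h1 h2 => ?_, fun j h => ?_⟩, ?_⟩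
    · rcases eq_or_ne j i with rfl | hj
      · simpa using hc
      · simpa [hj] using hw1 j h1 h2
    · have hj : j ≠ i := by rintro rfl; exact h ⟨hi, hin⟩
      simpa [hj] using hw2 j h
    · rw [hrev _ fun j hj => Function.update_of_ne hj.ne _ _, Function.update_self]
      congr 1
      refine chain_congr (fun j h1 h2 => ?_) fun j h1 h2 => ?_ <;>
        simp only [Function.update_of_ne (show n + 1 - j ≠ i by omega)]
  -- changing the `i`-th polygon and reflecting the part of the chain after it
  have hrefl : ∀ c ≤ k i - 4, ∃ w', IsChainVector n k w' ∧
      (chainPole n k w').kf = join (sides c (k i - 4 - c) A) B.flip := by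
    intro c hc
    refine ⟨fun j => if j = i then c else if i < j ∧ j < n then k j - 4 - w j else w j,
      ⟨fun j h1 h2 => ?_, fun j h => ?_⟩, ?_⟩
    · have := hw1 j h1 h2
      dsimp only
      split_ifs with h3 h4
      · rw [h3]; exact hc
      · omega
      · exact this
    · have := hw2 j h
      dsimp only
      rw [if_neg (by omega), if_neg (by omega), this]
    · rw [hrev _ fun j hj => by rw [if_neg (by omega), if_neg (by omega)]]
      simp only [if_true]
      congr 1
      refine chain_flip ?_ (fun j h1 h2 => ?_) fun j h1 h2 => ?_
      · simp only [Nat.add_sub_cancel]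
        rw [if_neg (by omega), if_neg (by omega)]
      · rw [if_neg (by omega), if_pos (by omega)]
      · have := hw1 (n + 1 - j) (by omega) (by omega)
        rw [if_neg (by omega), if_pos (by omega)]
        omega
  have hcur := hrev w fun _ _ => rfl
  have hcast : ((k i - 4 - w i : ℕ) : ℝ) = ((k i - 4 : ℕ) : ℝ) - w i := Nat.cast_sub hwi
  set M := k i - 4 with hM
  set e : ℝ := (w i : ℝ) - (M - w i : ℕ) with he
  have he2 : e = 2 * w i - M := by rw [he, hcast]; ring
  have hpos : 0 < A.res + B.res + ((w i : ℝ) + (M - w i : ℕ)) + 2 := by positivity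
  rcases Nat.even_or_odd' M with ⟨m, hm | hm⟩
  · have habs : 2 ≤ |e| := by
      rw [he2, le_abs]
      rcases hbad with h | h
      · right
        have : (2 * w i + 2 : ℝ) ≤ M := by exact_mod_cast h
        linarith
      · left
        have : (M + 2 : ℝ) ≤ 2 * w i := by exact_mod_cast h
        linarith
    obtain ⟨s, hs, hgain⟩ := exists_sign_gain hA1 hB1 habs
    have hm2 : M - m = m := by omega
    rcases hs with rfl | rfl
    · obtain ⟨h1, h2⟩ := hupd m (by omega)
      refine ⟨_, h1, ?_⟩
      rw [hcur, h2, ← sub_pos]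
      have key := join_sides_sub A B B hA0 hB0 rfl rfl rfl rfl rfl rfl (w i) (M - w i) m (M - m)
        (by omega)
      rw [hm2, ← he] at key
      rw [hm2]
      refine (mul_pos_iff_of_pos_left hpos).1 ?_
      rw [key]
      linarith
    · obtain ⟨w', h1, h2⟩ := hrefl m (by omega)
      refine ⟨w', h1, ?_⟩
      rw [hcur, h2, ← sub_pos]
      have key := join_sides_sub A B B.flip hA0 hB0 rfl rfl rfl rfl rfl (by simp [TwoPole.flip])
        (w i) (M - w i) m (M - m) (by omega)
      rw [hm2, ← he] at key
      rw [hm2]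
      refine (mul_pos_iff_of_pos_left hpos).1 ?_
      rw [key]
      simp only [TwoPole.flip]
      linarith
  · have habs : 3 ≤ |e| := by
      rw [he2, le_abs]
      rcases hbad with h | h
      · right
        have : (2 * w i + 3 : ℝ) ≤ M := by exact_mod_cast (show 2 * w i + 3 ≤ M by omega)
        linarith
      · left
        have : (M + 3 : ℝ) ≤ 2 * w i := by exact_mod_cast (show M + 3 ≤ 2 * w i by omega)
        linarith
    obtain ⟨s, hs, hgain⟩ := exists_unit_gain hA1 hB1 habs
    obtain ⟨c, hc, hcs⟩ : ∃ c ≤ M, (c : ℝ) - (M - c : ℕ) = s := by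
      rcases hs with rfl | rfl
      · refine ⟨m + 1, by omega, ?_⟩
        rw [show M - (m + 1) = m by omega]; push_cast; ring
      · refine ⟨m, by omega, ?_⟩
        rw [show M - m = m + 1 by omega]; push_cast; ring
    obtain ⟨h1, h2⟩ := hupd c hc
    refine ⟨_, h1, ?_⟩
    rw [hcur, h2, ← sub_pos]
    have key := join_sides_sub A B B hA0 hB0 rfl rfl rfl rfl rfl rfl (w i) (M - w i) c (M - c)
      (by omega)
    rw [hcs, ← he] at key
    refine (mul_pos_iff_of_pos_left hpos).1 ?_
    rw [key]
    linarith

theorem eq_floor_or_ceil {k c : ℕ} (hk : 4 ≤ k) (h1 : k - 4 < 2 * c + 2) (h2 : 2 * c < k - 4 + 2) :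
    (c : ℤ) = ⌊((k : ℚ) - 4) / 2⌋ ∨ (c : ℤ) = ⌈((k : ℚ) - 4) / 2⌉ := by
  obtain ⟨M, rfl⟩ := Nat.exists_eq_add_of_le' hk
  rw [Nat.add_sub_cancel] at h1 h2
  rw [eq_comm, Int.floor_eq_iff, eq_comm (b := ⌈_⌉), Int.ceil_eq_iff]
  push_cast
  rcases Nat.lt_or_ge M (2 * c) with h | h
  · right
    have h3 : (2 * c : ℚ) = M + 1 := by exact_mod_cast (show 2 * c = M + 1 by omega)
    constructor <;> linarith
  · left
    have h3 : (2 * c : ℚ) ≤ M := by exact_mod_cast h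
    have h4 : (M : ℚ) < 2 * c + 2 := by exact_mod_cast h1
    constructor <;> linarith

end Chain
end PolygonalChains

theorem theorem1 (n : ℕ) (hn : 1 ≤ n) (k : ℕ → ℕ) (hk : ∀ i, 1 ≤ i → i ≤ n → 4 ≤ k i) :
    (∃ w : ℕ → ℕ, PolygonalChains.IsChainVector n k w ∧
      ∀ w' : ℕ → ℕ, PolygonalChains.IsChainVector n k w' →
        PolygonalChains.kirchhoffIndex (PolygonalChains.polygonalChain n k w') ≤
          PolygonalChains.kirchhoffIndex (PolygonalChains.polygonalChain n k w)) ∧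
    ∀ w : ℕ → ℕ, PolygonalChains.IsChainVector n k w →
      (∀ w' : ℕ → ℕ, PolygonalChains.IsChainVector n k w' →
        PolygonalChains.kirchhoffIndex (PolygonalChains.polygonalChain n k w') ≤
          PolygonalChains.kirchhoffIndex (PolygonalChains.polygonalChain n k w)) →
      PolygonalChains.IsLinearChain n k w := by
  constructor
  · exact Set.exists_max_image {w | PolygonalChains.IsChainVector n k w}
      (fun w => PolygonalChains.kirchhoffIndex (PolygonalChains.polygonalChain n k w))
      (PolygonalChains.finite_isChainVector n k)
      ⟨fun _ => 0, fun _ _ _ => Nat.zero_le _, fun _ _ => rfl⟩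
  · intro w hw hmax i hi hin
    by_contra hlin
    have hbad : 2 * w i + 2 ≤ k i - 4 ∨ k i - 4 + 2 ≤ 2 * w i := by
      by_contra! h
      exact hlin (PolygonalChains.eq_floor_or_ceil (hk i (by omega) hin.le) h.1 h.2)
    obtain ⟨w', hw', hlt⟩ := PolygonalChains.exists_kf_lt hw hi hin hbad
    have := hmax w' hw'
    rw [PolygonalChains.kirchhoffIndex_polygonalChain,
      PolygonalChains.kirchhoffIndex_polygonalChain] at this
    exact absurd this (not_le.2 hlt)
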